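/- Let $\Gamma$ be a discrete group. For a class $\mathcal R$ of unitary representations of $\Gamma$ on complex Hilbert spaces let $C^*_{\mathcal R}(\Gamma)$ be the C$^*$-algebra obtained as the (separated) completion of the group ring $\mathbb C[\Gamma]$ with respect to the C$^*$-seminorm $\|x\|_{\mathcal R}=\sup\{\|\pi(x)\| : \pi\in\mathcal R\}$. If $\mathcal R$ consists of all unitary representations this is the full group C$^*$-algebra $C^*(\Gamma)$; if $\mathcal R$ consists of the left regular representation on $\ell^2(\Gamma)$ it is the reduced group C$^*$-algebra $C^*_r(\Gamma)$. For $p\in(0,\infty]$, an $\ell^p(\Gamma)$-representation is a unitary representation $\pi$ of $\Gamma$ on a Hilbert space $H$ for which there is a dense linear subspace $H_0\subseteq H$ such that for all $\xi,\eta\in H_0$ the matrix coefficient $s\mapsto\langle\pi_s\xi,\eta\rangle$ belongs to $\ell^p(\Gamma)$, an ideal of $\ell^\infty(\Gamma)$; if $\mathcal R$ consists of all $\ell^p(\Gamma)$-representations, $C^*_{\mathcal R}(\Gamma)$ is denoted by $C^*_{\ell^p}(\Gamma)$. Two such completions are called equal if there is a $*$-isomorphism between them that is compatible with the canonical maps from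 $\mathbb C[\Gamma]$. Proposition. Let $\mathbb F$ be a free group on two or more (possibly infinitely many) generators. There exists $p\in(2,\infty)$ such that $$C^*(\mathbb F)\neq C^*_{\ell^p}(\mathbb F)\neq C^*_r(\mathbb F).$$ -/

import Mathlib

open scoped ENNReal ComplexConjugate

universe u

noncomputable section

/-- A unitary representation `π : Γ → U(H)` of a discrete group on a complex Hilbert space. -/
structure UnitaryRep (Γ : Type u) [Group Γ] where
  H : Type u
  [instNACG : NormedAddCommGroup H]
  [instIPS : InnerProductSpace ℂ H]
  [instComplete : CompleteSpace H]
  hom : Γ →* unitary (H →L[ℂ] H)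

attribute [instance] UnitaryRep.instNACG UnitaryRep.instIPS UnitaryRep.instComplete

namespace UnitaryRep

variable {Γ : Type u} [Group Γ]

/-- The operator `π_s`. -/
def op (π : UnitaryRep Γ) (s : Γ) : π.H →L[ℂ] π.H := (π.hom s : π.H →L[ℂ] π.H)

theorem norm_op_apply (π : UnitaryRep Γ) (s : Γ) (ξ : π.H) : ‖π.op s ξ‖ = ‖ξ‖ :=
  (Unitary.linearIsometryEquiv (π.hom s)).norm_map ξ

theorem norm_op_le (π : UnitaryRep Γ) (s : Γ) : ‖π.op s‖ ≤ 1 :=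
  ContinuousLinearMap.opNorm_le_bound _ zero_le_one fun ξ => by rw [norm_op_apply, one_mul]

theorem adjoint_op (π : UnitaryRep Γ) (s : Γ) : star (π.op s) = π.op s⁻¹ := by
  simp only [op, map_inv]
  rfl

/-- The linear extension `π : ℂ[Γ] → B(H)` of a unitary representation. -/
def ext (π : UnitaryRep Γ) : MonoidAlgebra ℂ Γ →ₐ[ℂ] (π.H →L[ℂ] π.H) :=
  MonoidAlgebra.lift ℂ (π.H →L[ℂ] π.H) Γ ((unitary (π.H →L[ℂ] π.H)).subtype.comp π.hom)

theorem ext_single (π : UnitaryRep Γ) (s : Γ) (a : ℂ) :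
    π.ext (MonoidAlgebra.single s a) = a • π.op s := by
  simp [ext, op]

theorem ext_apply (π : UnitaryRep Γ) (x : MonoidAlgebra ℂ Γ) :
    π.ext x = x.coeff.sum fun s a => a • π.op s := by
  simp [ext, op, MonoidAlgebra.lift_apply]

theorem norm_ext_le (π : UnitaryRep Γ) (x : MonoidAlgebra ℂ Γ) :
    ‖π.ext x‖ ≤ x.coeff.sum fun _ a => ‖a‖ := by
  rw [ext_apply]
  refine (norm_sum_le _ _).trans (Finset.sum_le_sum fun s _ => ?_)
  rw [norm_smul]
  exact mul_le_of_le_one_right (norm_nonneg _) (π.norm_op_le s)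

/-- The matrix coefficient `π_{ξ,η}(s) = ⟨π_s ξ, η⟩` (linear in `ξ`, conjugate-linear in `η`),
as an element of `ℓ^∞(Γ)`. -/
def matrixCoeff (π : UnitaryRep Γ) (ξ η : π.H) : lp (fun _ : Γ => ℂ) ∞ :=
  ⟨fun s => inner ℂ η (π.op s ξ), memℓp_infty ⟨‖η‖ * ‖ξ‖, by
    rintro _ ⟨s, rfl⟩
    simpa [norm_op_apply] using norm_inner_le_norm (𝕜 := ℂ) η (π.op s ξ)⟩⟩

theorem matrixCoeff_apply (π : UnitaryRep Γ) (ξ η : π.H) (s : Γ) :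
    π.matrixCoeff ξ η s = inner ℂ η (π.op s ξ) := rfl

/-- `π` is a `D`-representation: there is a dense linear subspace all of whose matrix
coefficients lie in the ideal `D` of `ℓ^∞(Γ)`. -/
def IsIdealRep (D : Ideal (lp (fun _ : Γ => ℂ) ∞)) (π : UnitaryRep Γ) : Prop :=
  ∃ H₀ : Submodule ℂ π.H, Dense (H₀ : Set π.H) ∧
    ∀ ξ ∈ H₀, ∀ η ∈ H₀, π.matrixCoeff ξ η ∈ D

end UnitaryRep

section Ideals

variable (Γ : Type u)

/-- The ideal `ℓ^p(Γ)` of `ℓ^∞(Γ)`. -/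
def lpIdeal (p : ℝ≥0∞) : Ideal (lp (fun _ : Γ => ℂ) ∞) where
  carrier := {f | Memℓp (f : Γ → ℂ) p}
  zero_mem' := by
    simpa only [Set.mem_ofPred_eq, lp.coeFn_zero] using zero_memℓp
  add_mem' {f g} hf hg := by
    simpa only [Set.mem_ofPred_eq, lp.coeFn_add] using Memℓp.add hf hg
  smul_mem' c f hf := by
    have hc : ∀ s, ‖c s * f s‖ ≤ ‖((‖c‖ : ℂ) • (f : Γ → ℂ)) s‖ := fun s => by
      simpa using mul_le_mul_of_nonneg_right
        (lp.norm_apply_le_norm ENNReal.top_ne_zero c s) (norm_nonneg (f s))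
    have hf' : Memℓp ((‖c‖ : ℂ) • (f : Γ → ℂ)) p := Memℓp.const_smul hf _
    simp only [Set.mem_ofPred_eq, smul_eq_mul, lp.infty_coeFn_mul]
    rcases p.trichotomy with rfl | rfl | hp
    · refine memℓp_zero ((memℓp_zero_iff.1 hf).subset fun s hs h => hs ?_)
      simp [h]
    · exact (lp.memℓp c).infty_mul hf
    · exact memℓp_gen (Summable.of_nonneg_of_le (fun s => by positivity)
        (fun s => Real.rpow_le_rpow (norm_nonneg _) (hc s) hp.le) (hf'.summable hp))

end Ideals

section Regular

variable (Γ : Type u) [Group Γ]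

theorem memℓp_translate {Γ : Type u} [Group Γ] (s : Γ) {f : Γ → ℂ} (hf : Memℓp f 2) :
    Memℓp (fun t => f (s⁻¹ * t)) 2 :=
  memℓp_gen ((Equiv.mulLeft s⁻¹).summable_iff.2 (hf.summable (by norm_num)))

/-- Left translation `(λ_s f)(t) = f(s⁻¹ t)` on `ℓ²(Γ)`. -/
def leftTranslate {Γ : Type u} [Group Γ] (s : Γ) :
    lp (fun _ : Γ => ℂ) 2 ≃ₗᵢ[ℂ] lp (fun _ : Γ => ℂ) 2 where
  toFun f := ⟨fun t => f (s⁻¹ * t), memℓp_translate s (lp.memℓp f)⟩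
  invFun f := ⟨fun t => f (s⁻¹⁻¹ * t), memℓp_translate s⁻¹ (lp.memℓp f)⟩
  map_add' f g := rfl
  map_smul' c f := rfl
  left_inv f := by
    apply lp.ext
    funext t
    simp
  right_inv f := by
    apply lp.ext
    funext t
    simp
  norm_map' f := by
    rw [lp.norm_eq_tsum_rpow (by norm_num), lp.norm_eq_tsum_rpow (by norm_num)]
    congr 1
    exact (Equiv.mulLeft s⁻¹).tsum_eq fun t => ‖f t‖ ^ (2 : ℝ≥0∞).toReal

/-- The left regular representation of `Γ` on `ℓ²(Γ)`. -/
def leftRegularRep : UnitaryRep Γ where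
  H := lp (fun _ : Γ => ℂ) 2
  hom :=
    { toFun := fun s => Unitary.linearIsometryEquiv.symm (leftTranslate s)
      map_one' := by
        rw [← map_one Unitary.linearIsometryEquiv.symm]
        congr 1
        ext f : 1
        apply lp.ext
        funext t
        simp [leftTranslate]
      map_mul' := fun s t => by
        rw [← map_mul]
        congr 1
        ext f : 1
        apply lp.ext
        funext r
        change f ((s * t)⁻¹ * r) = f (t⁻¹ * (s⁻¹ * r))
        rw [mul_inv_rev, mul_assoc] }

theorem leftRegularRep_op_apply (s t : Γ) (f : lp (fun _ : Γ => ℂ) 2) :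
    (show lp (fun _ : Γ => ℂ) 2 from (leftRegularRep Γ).op s f) t = f (s⁻¹ * t) := rfl

end Regular

section Completion

variable {Γ : Type u} [Group Γ]

/-- The norm `‖x‖_R = sup {‖π(x)‖ : π ∈ R}` on `ℂ[Γ]` attached to a class `R` of unitary
representations. -/
def repNorm (R : Set (UnitaryRep Γ)) (x : MonoidAlgebra ℂ Γ) : ℝ :=
  ⨆ π : R, ‖π.1.ext x‖

theorem bddAbove_repNorm (R : Set (UnitaryRep Γ)) (x : MonoidAlgebra ℂ Γ) :
    BddAbove (Set.range fun π : R => ‖π.1.ext x‖) :=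
  ⟨_, by rintro _ ⟨π, rfl⟩; exact π.1.norm_ext_le x⟩

theorem norm_ext_le_repNorm {R : Set (UnitaryRep Γ)} {π : UnitaryRep Γ} (hπ : π ∈ R)
    (x : MonoidAlgebra ℂ Γ) : ‖π.ext x‖ ≤ repNorm R x :=
  le_ciSup (bddAbove_repNorm R x) ⟨π, hπ⟩

theorem repNorm_nonneg (R : Set (UnitaryRep Γ)) (x : MonoidAlgebra ℂ Γ) : 0 ≤ repNorm R x :=
  Real.iSup_nonneg fun _ => norm_nonneg _

theorem repNorm_le {R : Set (UnitaryRep Γ)} {x : MonoidAlgebra ℂ Γ} {C : ℝ} (hC : 0 ≤ C)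
    (h : ∀ π ∈ R, ‖π.ext x‖ ≤ C) : repNorm R x ≤ C :=
  Real.iSup_le (fun π => h π.1 π.2) hC

/-- The group ring `ℂ[Γ]`, regarded as carrying the seminorm `repNorm R`. -/
def PreGroupCStar (_R : Set (UnitaryRep Γ)) : Type u := MonoidAlgebra ℂ Γ

namespace PreGroupCStar

variable (R : Set (UnitaryRep Γ))

instance : Ring (PreGroupCStar R) := inferInstanceAs (Ring (MonoidAlgebra ℂ Γ))

instance : Algebra ℂ (PreGroupCStar R) := inferInstanceAs (Algebra ℂ (MonoidAlgebra ℂ Γ))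

/-- The identity map from the group ring. -/
def of : MonoidAlgebra ℂ Γ ≃ₐ[ℂ] PreGroupCStar R := AlgEquiv.refl

instance : Norm (PreGroupCStar R) := ⟨fun x => repNorm R ((of R).symm x)⟩

theorem norm_def (x : PreGroupCStar R) : ‖x‖ = repNorm R ((of R).symm x) := rfl

instance : SeminormedRing (PreGroupCStar R) :=
  { (inferInstance : Ring (PreGroupCStar R)),
    SeminormedAddCommGroup.ofCore (𝕜 := ℂ) (E := PreGroupCStar R)
      { norm_nonneg := fun x => repNorm_nonneg R _
        norm_smul := fun c x => by
          simp only [norm_def, map_smul, repNorm, norm_smul]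
          exact (Real.mul_iSup_of_nonneg (norm_nonneg c) _).symm
        norm_triangle := fun x y => by
          refine repNorm_le (add_nonneg (repNorm_nonneg R _) (repNorm_nonneg R _)) fun π hπ => ?_
          rw [map_add, map_add]
          exact (norm_add_le _ _).trans
            (add_le_add (norm_ext_le_repNorm hπ _) (norm_ext_le_repNorm hπ _)) } with
    norm_mul_le := fun x y => by
      refine repNorm_le (mul_nonneg (repNorm_nonneg R _) (repNorm_nonneg R _)) fun π hπ => ?_
      rw [map_mul, map_mul]
      exact (norm_mul_le _ _).trans
        (mul_le_mul (norm_ext_le_repNorm hπ _) (norm_ext_le_repNorm hπ _) (norm_nonneg _)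
          (repNorm_nonneg R _)) }

instance : NormedAlgebra ℂ (PreGroupCStar R) where
  norm_smul_le c x := by
    refine repNorm_le (mul_nonneg (norm_nonneg c) (repNorm_nonneg R _)) fun π hπ => ?_
    rw [map_smul, map_smul, norm_smul]
    exact mul_le_mul_of_nonneg_left (norm_ext_le_repNorm hπ _) (norm_nonneg c)

/-- The involution `(∑ a_s s)^* = ∑ conj(a_s) s⁻¹`. -/
instance : Star (PreGroupCStar R) :=
  ⟨fun x => of R (((of R).symm x).coeff.sum fun s a => MonoidAlgebra.single s⁻¹ (conj a))⟩

theorem star_of_single (s : Γ) (a : ℂ) :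
    star (of R (MonoidAlgebra.single s a)) = of R (MonoidAlgebra.single s⁻¹ (conj a)) := by
  change of R ((MonoidAlgebra.single s a).coeff.sum
    fun s a => MonoidAlgebra.single s⁻¹ (conj a)) = _
  simp

theorem star_add_aux (x y : PreGroupCStar R) : star (x + y) = star x + star y := by
  change of R ((((of R).symm (x + y)).coeff).sum
    fun s a => MonoidAlgebra.single s⁻¹ (conj a)) = of R _ + of R _
  rw [← map_add, map_add, MonoidAlgebra.coeff_add, Finsupp.sum_add_index'] <;> simp

theorem induct {P : PreGroupCStar R → Prop} (x : PreGroupCStar R)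
    (h₀ : ∀ s a, P (of R (MonoidAlgebra.single s a)))
    (h₁ : ∀ x y, P x → P y → P (x + y)) : P x := by
  obtain ⟨y, rfl⟩ := (of R).surjective x
  refine MonoidAlgebra.induction_linear y ?_ (fun f g hf hg => ?_) h₀
  · simpa using h₀ 1 0
  · rw [map_add]
    exact h₁ _ _ hf hg

instance : StarRing (PreGroupCStar R) where
  star_involutive x := by
    induction x using induct with
    | h₀ s a => simp [star_of_single]
    | h₁ x y hx hy => rw [star_add_aux, star_add_aux, hx, hy]
  star_add := star_add_aux R
  star_mul x y := by
    induction x using induct with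
    | h₁ x y hx hy => rw [add_mul, star_add_aux, star_add_aux, mul_add, hx, hy]
    | h₀ s a =>
      induction y using induct with
      | h₁ x y hx hy => rw [mul_add, star_add_aux, star_add_aux, add_mul, hx, hy]
      | h₀ t b =>
        simp only [← map_mul, star_of_single, MonoidAlgebra.single_mul_single, mul_inv_rev]
        rw [mul_comm a b]

instance : StarModule ℂ (PreGroupCStar R) where
  star_smul c x := by
    induction x using induct with
    | h₀ s a => simp [← map_smul, star_of_single]
    | h₁ x y hx hy => rw [smul_add, star_add, hx, hy, star_add, smul_add]

theorem ext_star (π : UnitaryRep Γ) (x : PreGroupCStar R) :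
    π.ext ((of R).symm (star x)) = star (π.ext ((of R).symm x)) := by
  induction x using induct with
  | h₀ s a => simp [star_of_single, UnitaryRep.ext_single, UnitaryRep.adjoint_op]
  | h₁ x y hx hy => simp only [star_add, map_add, hx, hy]

theorem norm_star_eq (x : PreGroupCStar R) : ‖star x‖ = ‖x‖ := by
  simp only [norm_def, repNorm, ext_star, norm_star]

instance : NormedStarGroup (PreGroupCStar R) where
  norm_star_le x := (norm_star_eq R x).le

theorem cstar_le (x : PreGroupCStar R) : ‖x‖ * ‖x‖ ≤ ‖star x * x‖ := by
  have h : ‖x‖ ≤ Real.sqrt ‖star x * x‖ := by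
    refine repNorm_le (Real.sqrt_nonneg _) fun π hπ => Real.le_sqrt_of_sq_le ?_
    rw [sq, ← CStarRing.norm_star_mul_self, ← ext_star, ← map_mul, ← map_mul]
    exact norm_ext_le_repNorm hπ _
  calc ‖x‖ * ‖x‖ ≤ Real.sqrt ‖star x * x‖ * Real.sqrt ‖star x * x‖ :=
        mul_self_le_mul_self (norm_nonneg _) h
    _ = ‖star x * x‖ := Real.mul_self_sqrt (norm_nonneg _)

end PreGroupCStar

/-- The C⋆-algebra obtained by (separating and) completing `ℂ[Γ]` with respect to
`‖x‖_R = sup {‖π(x)‖ : π ∈ R}`. -/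
def GroupCStar (R : Set (UnitaryRep Γ)) : Type u := UniformSpace.Completion (PreGroupCStar R)

namespace GroupCStar

open UniformSpace

variable (R : Set (UnitaryRep Γ))

instance : NormedRing (GroupCStar R) :=
  inferInstanceAs (NormedRing (Completion (PreGroupCStar R)))

instance : CompleteSpace (GroupCStar R) :=
  inferInstanceAs (CompleteSpace (Completion (PreGroupCStar R)))

instance : Algebra ℂ (GroupCStar R) :=
  inferInstanceAs (Algebra ℂ (Completion (PreGroupCStar R)))

instance : NormedAlgebra ℂ (GroupCStar R) where
  norm_smul_le := norm_smul_le (α := ℂ) (β := Completion (PreGroupCStar R))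

instance : Star (GroupCStar R) :=
  ⟨(Completion.map star : Completion (PreGroupCStar R) → Completion (PreGroupCStar R))⟩

theorem continuous_star_aux : Continuous (star : GroupCStar R → GroupCStar R) :=
  Completion.continuous_map

/-- The canonical map `ℂ[Γ] → C^*_R(Γ)`. -/
def ofGroupRing : MonoidAlgebra ℂ Γ →ₐ[ℂ] GroupCStar R :=
  { (Completion.coeRingHom : PreGroupCStar R →+* Completion (PreGroupCStar R)).comp
      ((PreGroupCStar.of R : MonoidAlgebra ℂ Γ ≃ₐ[ℂ] PreGroupCStar R) :
        MonoidAlgebra ℂ Γ →+* PreGroupCStar R) with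
    commutes' := fun c => by
      change ((PreGroupCStar.of R (algebraMap ℂ _ c) : PreGroupCStar R) :
        Completion (PreGroupCStar R)) = algebraMap ℂ (Completion (PreGroupCStar R)) c
      rw [AlgEquiv.commutes]
      rfl }

theorem star_ofGroupRing (x : MonoidAlgebra ℂ Γ) :
    star (ofGroupRing R x) =
      ofGroupRing R ((PreGroupCStar.of R).symm (star (PreGroupCStar.of R x))) :=
  Completion.map_coe (f := (star : PreGroupCStar R → PreGroupCStar R))
    (uniformContinuous_of_continuousAt_zero
      (starAddEquiv : PreGroupCStar R ≃+ PreGroupCStar R).toAddMonoidHom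
        continuous_star.continuousAt) _

theorem norm_ofGroupRing (x : MonoidAlgebra ℂ Γ) : ‖ofGroupRing R x‖ = repNorm R x :=
  Completion.norm_coe (PreGroupCStar.of R x)

theorem denseRange_ofGroupRing : DenseRange (ofGroupRing R) :=
  (Completion.denseRange_coe (α := PreGroupCStar R)).comp
    (PreGroupCStar.of R).surjective.denseRange (Completion.continuous_coe _)

instance : StarRing (GroupCStar R) where
  star_involutive x := by
    refine (denseRange_ofGroupRing R).induction_on x (isClosed_eq
      ((continuous_star_aux R).comp (continuous_star_aux R)) continuous_id) fun a => ?_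
    simp [star_ofGroupRing]
  star_add x y := by
    refine (denseRange_ofGroupRing R).induction_on₂ (isClosed_eq
      ((continuous_star_aux R).comp (continuous_fst.add continuous_snd))
      (((continuous_star_aux R).comp continuous_fst).add
        ((continuous_star_aux R).comp continuous_snd))) (fun a b => ?_) x y
    rw [← map_add, star_ofGroupRing, star_ofGroupRing, star_ofGroupRing, map_add, star_add,
      map_add, map_add]
  star_mul x y := by
    refine (denseRange_ofGroupRing R).induction_on₂ (isClosed_eq
      ((continuous_star_aux R).comp (continuous_fst.mul continuous_snd))
      (((continuous_star_aux R).comp continuous_snd).mul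
        ((continuous_star_aux R).comp continuous_fst))) (fun a b => ?_) x y
    rw [← map_mul, star_ofGroupRing, star_ofGroupRing, star_ofGroupRing, map_mul, star_mul,
      map_mul, map_mul]

instance : StarModule ℂ (GroupCStar R) where
  star_smul c x := by
    refine (denseRange_ofGroupRing R).induction_on x (isClosed_eq
      ((continuous_star_aux R).comp (continuous_const_smul c))
      ((continuous_star_aux R).const_smul (star c))) fun a => ?_
    rw [← map_smul, star_ofGroupRing, star_ofGroupRing, map_smul, star_smul, map_smul, map_smul]

instance : CStarRing (GroupCStar R) where
  norm_mul_self_le x := by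
    refine (denseRange_ofGroupRing R).induction_on x (isClosed_le
      (continuous_norm.mul continuous_norm)
      (((continuous_star_aux R).mul continuous_id).norm)) fun a => ?_
    rw [star_ofGroupRing, ← map_mul, norm_ofGroupRing, norm_ofGroupRing]
    have h := PreGroupCStar.cstar_le R (PreGroupCStar.of R a)
    simpa [PreGroupCStar.norm_def] using h

instance : CStarAlgebra (GroupCStar R) where

end GroupCStar

variable (Γ) in
/-- The full group C⋆-algebra `C^*(Γ)`. -/
abbrev FullGroupCStar : Type u := GroupCStar (Set.univ : Set (UnitaryRep Γ))

variable (Γ) in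
/-- The reduced group C⋆-algebra `C^*_r(Γ)`. -/
abbrev ReducedGroupCStar : Type u := GroupCStar {leftRegularRep Γ}

/-- The ideal completion `C^*_D(Γ)`. -/
abbrev IdealGroupCStar (D : Ideal (lp (fun _ : Γ => ℂ) ∞)) : Type u :=
  GroupCStar {π : UnitaryRep Γ | π.IsIdealRep D}

end Completion

end

theorem repNorm_eq_of_starAlgEquiv {Γ : Type u} [Group Γ] {R R' : Set (UnitaryRep Γ)}
    (φ : GroupCStar R ≃⋆ₐ[ℂ] GroupCStar R')
    (hφ : ∀ x, φ (GroupCStar.ofGroupRing R x) = GroupCStar.ofGroupRing R' x)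
    (x : MonoidAlgebra ℂ Γ) : repNorm R x = repNorm R' x := by
  rw [← GroupCStar.norm_ofGroupRing, ← GroupCStar.norm_ofGroupRing, ← hφ]
  exact (StarAlgEquiv.norm_map φ _).symm

/-- A self-adjoint operator whose diagonal moments grow at most like `C ^ n` on a dense subspace
has norm at most `C`. -/
theorem IsSelfAdjoint.norm_le_of_moments {H : Type*} [NormedAddCommGroup H]
    [InnerProductSpace ℂ H] [CompleteSpace H] {T : H →L[ℂ] H} (hT : IsSelfAdjoint T)
    {C : ℝ} (hC : 0 < C) {S : Set H} (hS : Dense S)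
    (h : ∀ ξ ∈ S, ∃ K : ℝ, ∀ n : ℕ, ‖inner ℂ ξ ((T ^ n) ξ)‖ ≤ K * C ^ n) : ‖T‖ ≤ C := by
  have sq_eq : ∀ (n : ℕ) (ξ : H), ‖(T ^ n) ξ‖ ^ 2 = ‖inner ℂ ξ ((T ^ (2 * n)) ξ)‖ := by
    intro n ξ
    have h1 : inner ℂ ((T ^ n) ξ) ((T ^ n) ξ) = inner ℂ ξ ((T ^ (2 * n)) ξ) := by
      have h2 : ContinuousLinearMap.adjoint (T ^ n) = T ^ n := hT.pow n
      have h3 := ContinuousLinearMap.adjoint_inner_right (T ^ n) ξ ((T ^ n) ξ)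
      rw [h2] at h3
      rw [two_mul, pow_add, mul_apply_eq_comp, h3]
    rw [← h1, inner_self_eq_norm_sq_to_K]
    simp
  have key : ∀ ξ ∈ S, ‖T ξ‖ ≤ C * ‖ξ‖ := by
    intro ξ hξ
    obtain ⟨K, hK⟩ := h ξ hξ
    rcases eq_or_ne ξ 0 with rfl | h0
    · simp
    have hpos : 0 < ‖ξ‖ := norm_pos_iff.2 h0
    have step : ∀ k : ℕ, (‖T ξ‖ / ‖ξ‖) ^ (2 ^ k) ≤ ‖(T ^ (2 ^ k)) ξ‖ / ‖ξ‖ := by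
      intro k
      induction k with
      | zero => simp
      | succ k ih =>
        rw [pow_succ 2 k, pow_mul]
        calc ((‖T ξ‖ / ‖ξ‖) ^ 2 ^ k) ^ 2 ≤ (‖(T ^ (2 ^ k)) ξ‖ / ‖ξ‖) ^ 2 := by gcongr
          _ = ‖inner ℂ ξ ((T ^ (2 * 2 ^ k)) ξ)‖ / ‖ξ‖ ^ 2 := by rw [div_pow, sq_eq]
          _ ≤ ‖ξ‖ * ‖(T ^ (2 * 2 ^ k)) ξ‖ / ‖ξ‖ ^ 2 := by
              gcongr
              exact norm_inner_le_norm _ _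
          _ = ‖(T ^ (2 ^ k * 2)) ξ‖ / ‖ξ‖ := by
              rw [mul_comm 2]
              field_simp
    have bound : ∀ k : ℕ, ((‖T ξ‖ / ‖ξ‖ / C) ^ 2) ^ (2 ^ k) ≤ K / ‖ξ‖ ^ 2 := by
      intro k
      rw [pow_right_comm, div_pow, div_pow _ _ 2, div_le_iff₀ (by positivity)]
      calc ((‖T ξ‖ / ‖ξ‖) ^ 2 ^ k) ^ 2 ≤ (‖(T ^ (2 ^ k)) ξ‖ / ‖ξ‖) ^ 2 := by
            gcongr
            exact step k
        _ = ‖inner ℂ ξ ((T ^ (2 * 2 ^ k)) ξ)‖ / ‖ξ‖ ^ 2 := by rw [div_pow, sq_eq]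
        _ ≤ K * C ^ (2 * 2 ^ k) / ‖ξ‖ ^ 2 := by
            gcongr
            exact hK _
        _ = K / ‖ξ‖ ^ 2 * (C ^ 2 ^ k) ^ 2 := by
            rw [mul_comm 2, pow_mul]
            ring
    have hle : (‖T ξ‖ / ‖ξ‖ / C) ^ 2 ≤ 1 := by
      by_contra! hgt
      have ht := (tendsto_pow_atTop_atTop_of_one_lt hgt).comp
        (tendsto_pow_atTop_atTop_of_one_lt (one_lt_two (α := ℕ)))
      obtain ⟨k, hk⟩ := (ht.eventually_gt_atTop (K / ‖ξ‖ ^ 2)).exists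
      exact (bound k).not_gt hk
    have h1 : ‖T ξ‖ / ‖ξ‖ / C ≤ 1 := by
      rw [sq_le_one_iff₀ (by positivity)] at hle
      exact hle
    rwa [div_le_one hC, div_le_iff₀ hpos] at h1
  refine T.opNorm_le_bound hC.le fun ξ => ?_
  exact hS.induction (P := fun ξ => ‖T ξ‖ ≤ C * ‖ξ‖) key
    (isClosed_le (by fun_prop) (by fun_prop)) ξ

/-- The Schur test for a sum of left translations. -/
theorem norm_sum_leftRegularRep_op_le {Γ : Type u} [Group Γ] {L : Type*} [Fintype L]
    (ψ : L → Γ) (w : L → Γ → ℝ) (hw : ∀ g s, 0 < w g s) {c : ℝ} (hc : 0 ≤ c)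
    (h₁ : ∀ s, ∑ g, w g s ≤ c) (h₂ : ∀ s, ∑ g, (w g (ψ g * s))⁻¹ ≤ c) :
    ‖∑ g, (leftRegularRep Γ).op (ψ g)‖ ≤ c := by
  refine ContinuousLinearMap.opNorm_le_bound _ hc fun f => ?_
  change lp (fun _ : Γ => ℂ) 2 at f
  have hns : ∀ f : lp (fun _ : Γ => ℂ) 2, HasSum (fun s => ‖f s‖ ^ 2) (‖f‖ ^ 2) := fun f => by
    simpa using lp.hasSum_norm (p := 2) (by norm_num) f
  set F : lp (fun _ : Γ => ℂ) 2 := ∑ g, leftTranslate (ψ g) f with hF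
  have hTF : (∑ g, (leftRegularRep Γ).op (ψ g)) f = F := sum_apply _ _ _
  change ‖(∑ g, (leftRegularRep Γ).op (ψ g)) f‖ ≤ c * ‖f‖
  rw [hTF]
  change ‖F‖ ≤ c * ‖f‖
  have hFs : ∀ s, F s = ∑ g, f ((ψ g)⁻¹ * s) := fun s => by
    rw [hF, lp.coeFn_sum, Finset.sum_apply]
    rfl
  have hv : ∀ g s, (w g (ψ g * s))⁻¹ ≤ c := fun g s =>
    (Finset.single_le_sum (f := fun g => (w g (ψ g * s))⁻¹)
      (fun g _ => (inv_pos.2 (hw _ _)).le) (Finset.mem_univ g)).trans (h₂ s)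
  have hsum : ∀ g, Summable fun s => ‖f s‖ ^ 2 * (w g (ψ g * s))⁻¹ := fun g =>
    Summable.of_nonneg_of_le (fun s => mul_nonneg (by positivity) (inv_pos.2 (hw _ _)).le)
      (fun s => mul_le_mul_of_nonneg_left (hv g s) (by positivity))
      ((hns f).summable.mul_right c)
  have hsum' : ∀ g, HasSum (fun s => ‖f ((ψ g)⁻¹ * s)‖ ^ 2 * (w g s)⁻¹)
      (∑' s, ‖f s‖ ^ 2 * (w g (ψ g * s))⁻¹) := fun g => by
    have := (Equiv.mulLeft (ψ g)⁻¹).hasSum_iff.2 (hsum g).hasSum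
    simpa [Function.comp_def] using this
  have hle : ‖F‖ ^ 2 ≤ c * ∑ g, ∑' s, ‖f s‖ ^ 2 * (w g (ψ g * s))⁻¹ := by
    refine hasSum_le (fun s => ?_) (hns F) ((hasSum_sum fun g _ => hsum' g).mul_left c)
    calc ‖F s‖ ^ 2 ≤ (∑ g, ‖f ((ψ g)⁻¹ * s)‖) ^ 2 := by
          rw [hFs]
          gcongr
          exact norm_sum_le _ _
      _ ≤ (∑ g, w g s) * ∑ g, ‖f ((ψ g)⁻¹ * s)‖ ^ 2 * (w g s)⁻¹ := by
          refine Finset.sum_sq_le_sum_mul_sum_of_sq_le_mul _ (fun g _ => (hw g s).le)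
            (fun g _ => mul_nonneg (by positivity) (inv_pos.2 (hw g s)).le) fun g _ => ?_
          have := (hw g s).ne'
          exact (by field_simp : _ = _).le
      _ ≤ c * ∑ g, ‖f ((ψ g)⁻¹ * s)‖ ^ 2 * (w g s)⁻¹ := by
          refine mul_le_mul_of_nonneg_right (h₁ s) (Finset.sum_nonneg fun g _ => ?_)
          exact mul_nonneg (by positivity) (inv_pos.2 (hw g s)).le
  have hle' : ∑ g, ∑' s, ‖f s‖ ^ 2 * (w g (ψ g * s))⁻¹ ≤ ‖f‖ ^ 2 * c := by
    refine hasSum_le (fun s => ?_) (hasSum_sum fun g _ => (hsum g).hasSum)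
      ((hns f).mul_right c)
    rw [← Finset.mul_sum]
    exact mul_le_mul_of_nonneg_left (h₂ s) (by positivity)
  refine (sq_le_sq₀ (norm_nonneg _) (by positivity)).1 ?_
  calc ‖F‖ ^ 2 ≤ c * (‖f‖ ^ 2 * c) := hle.trans (mul_le_mul_of_nonneg_left hle' hc)
    _ = (c * ‖f‖) ^ 2 := by ring

theorem leftRegularRep_ext_single_one {Γ : Type u} [Group Γ] [DecidableEq Γ]
    (y : MonoidAlgebra ℂ Γ) (s : Γ) :
    (show lp (fun _ : Γ => ℂ) 2 from
      (leftRegularRep Γ).ext y (lp.single 2 (1 : Γ) (1 : ℂ) : lp (fun _ : Γ => ℂ) 2)) s =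
      y.coeff s := by
  induction y using MonoidAlgebra.induction_linear with
  | zero =>
    rw [map_zero]
    rfl
  | add y z hy hz =>
    rw [map_add, MonoidAlgebra.coeff_add, Finsupp.add_apply, ← hy, ← hz]
    rfl
  | single t a =>
    rw [UnitaryRep.ext_single]
    change a * (lp.single 2 (1 : Γ) (1 : ℂ) : lp (fun _ : Γ => ℂ) 2) (t⁻¹ * s) = _
    rw [lp.single_apply, MonoidAlgebra.coeff_single, Finsupp.single_apply, Pi.single_apply]
    simp [inv_mul_eq_one]

theorem norm_coeff_le_norm_leftRegularRep_ext {Γ : Type u} [Group Γ]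
    (y : MonoidAlgebra ℂ Γ) (s : Γ) : ‖y.coeff s‖ ≤ ‖(leftRegularRep Γ).ext y‖ := by
  classical
  rw [← leftRegularRep_ext_single_one]
  refine (lp.norm_apply_le_norm two_ne_zero _ s).trans ?_
  refine (ContinuousLinearMap.le_opNorm _ _).trans ?_
  have : ‖(lp.single 2 (1 : Γ) (1 : ℂ) : lp (fun _ : Γ => ℂ) 2)‖ = 1 := by
    rw [lp.norm_single (by norm_num)]
    simp
  exact (congrArg (_ * ·) this).le.trans (mul_one _).le

/-- The sum `∑ g, ψ g` in the group ring. -/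
noncomputable def groupSum {Γ : Type u} [Group Γ] {L : Type*} [Fintype L] (ψ : L → Γ) :
    MonoidAlgebra ℂ Γ :=
  ∑ g, MonoidAlgebra.single (ψ g) 1

section groupSum

variable {Γ : Type u} [Group Γ] {L : Type*} [Fintype L] (ψ : L → Γ)

theorem UnitaryRep.ext_groupSum (π : UnitaryRep Γ) :
    π.ext (groupSum ψ) = ∑ g, π.op (ψ g) := by
  simp [groupSum, UnitaryRep.ext_single]

theorem sum_norm_coeff_groupSum_pow (m : ℕ) :
    ∑ s ∈ (groupSum ψ ^ m).coeff.support, ‖(groupSum ψ ^ m).coeff s‖ =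
      (Fintype.card L : ℝ) ^ m := by
  set y : MonoidAlgebra ℕ Γ := (∑ g, MonoidAlgebra.single (ψ g) 1) ^ m with hy
  have h1 : groupSum ψ ^ m = MonoidAlgebra.mapRingHom Γ (Nat.castRingHom ℂ) y := by
    simp [hy, groupSum]
  have h2 : ∀ s, (groupSum ψ ^ m).coeff s = (y.coeff s : ℂ) := fun s => by
    rw [h1]
    simp
  have h3 : (groupSum ψ ^ m).coeff.support = y.coeff.support := by
    ext s
    simp [h2]
  have h4 : MonoidAlgebra.lift ℕ ℕ Γ 1 y = Fintype.card L ^ m := by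
    simp [hy]
  rw [MonoidAlgebra.lift_apply, Finsupp.sum] at h4
  simp only [MonoidHom.one_apply, smul_eq_mul, mul_one] at h4
  rw [h3, ← Nat.cast_pow, ← h4, Nat.cast_sum]
  exact Finset.sum_congr rfl fun s _ => by rw [h2, Complex.norm_natCast]

theorem UnitaryRep.inner_ext_eq_sum (π : UnitaryRep Γ) (y : MonoidAlgebra ℂ Γ) (ξ η : π.H) :
    inner ℂ η (π.ext y ξ) = ∑ s ∈ y.coeff.support, y.coeff s * π.matrixCoeff ξ η s := by
  rw [UnitaryRep.ext_apply, Finsupp.sum, sum_apply, inner_sum]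
  simp [inner_smul_right, UnitaryRep.matrixCoeff_apply]

/-- If the norm of a symmetric sum of group elements in the regular representation is at most `ρ`,
its norm in every `ℓ^p`-representation is at most an interpolated value. -/
theorem UnitaryRep.IsIdealRep.norm_ext_groupSum_le (e : L ≃ L) (he : ∀ g, ψ (e g) = (ψ g)⁻¹)
    [Nonempty L] {ρ : ℝ} (hρ : 0 < ρ) (hψ : ‖(leftRegularRep Γ).ext (groupSum ψ)‖ ≤ ρ)
    {p : ℝ≥0∞} (hp : 1 ≤ p) (hp' : p ≠ ∞) {π : UnitaryRep Γ} (hπ : π.IsIdealRep (lpIdeal Γ p)) :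
    ‖π.ext (groupSum ψ)‖ ≤
      (Fintype.card L : ℝ) ^ (1 - p.toReal⁻¹) * ρ ^ p.toReal⁻¹ := by
  obtain ⟨H₀, hd, hH₀⟩ := hπ
  set N : ℝ := (Fintype.card L : ℝ)
  have hN : 0 < N := Nat.cast_pos.2 Fintype.card_pos
  set q := p.toReal with hq
  have hq1 : 1 ≤ q := by
    rw [hq, ← ENNReal.toReal_one]
    exact ENNReal.toReal_mono hp' hp
  have hq0 : 0 < q := by linarith
  have hqi : q⁻¹ ≤ 1 := inv_le_one_of_one_le₀ hq1
  have hsa : IsSelfAdjoint (π.ext (groupSum ψ)) := by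
    rw [π.ext_groupSum, isSelfAdjoint_iff, star_sum, ← e.sum_comp fun g => π.op (ψ g)]
    exact Finset.sum_congr rfl fun g _ => by rw [UnitaryRep.adjoint_op, he]
  refine hsa.norm_le_of_moments (by positivity) hd fun ξ hξ => ?_
  have hf : Summable fun s => ‖π.matrixCoeff ξ ξ s‖ ^ q :=
    (show Memℓp (π.matrixCoeff ξ ξ : Γ → ℂ) p from hH₀ ξ hξ ξ hξ).summable hq0
  refine ⟨(∑' s, ‖π.matrixCoeff ξ ξ s‖ ^ q) ^ q⁻¹, fun m => ?_⟩
  rw [← map_pow, UnitaryRep.inner_ext_eq_sum]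
  set y := groupSum ψ ^ m with hy
  have hcoeff : ∀ s, ‖y.coeff s‖ ≤ ρ ^ m := fun s => by
    refine (norm_coeff_le_norm_leftRegularRep_ext y s).trans ?_
    rw [hy, map_pow]
    rcases m.eq_zero_or_pos with rfl | hm
    · exact (ContinuousLinearMap.norm_id_le (𝕜 := ℂ)).trans (pow_zero ρ).ge
    · exact (norm_pow_le' _ hm).trans (pow_le_pow_left₀ (norm_nonneg _) hψ m)
  have hA : 0 ≤ ∑' s, ‖π.matrixCoeff ξ ξ s‖ ^ q := tsum_nonneg fun s => by positivity
  calc ‖∑ s ∈ y.coeff.support, y.coeff s * π.matrixCoeff ξ ξ s‖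
      ≤ ∑ s ∈ y.coeff.support, ‖y.coeff s‖ * ‖π.matrixCoeff ξ ξ s‖ := by
        refine (norm_sum_le _ _).trans (Finset.sum_le_sum fun s _ => ?_)
        rw [norm_mul]
    _ ≤ (∑ s ∈ y.coeff.support, ‖y.coeff s‖) ^ (1 - q⁻¹) *
          (∑ s ∈ y.coeff.support, ‖y.coeff s‖ * ‖π.matrixCoeff ξ ξ s‖ ^ q) ^ q⁻¹ :=
        Real.inner_le_weight_mul_Lp_of_nonneg _ hq1 _ _ (fun _ => norm_nonneg _)
          fun _ => norm_nonneg _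
    _ ≤ (N ^ m) ^ (1 - q⁻¹) * (ρ ^ m * ∑' s, ‖π.matrixCoeff ξ ξ s‖ ^ q) ^ q⁻¹ := by
        rw [hy, sum_norm_coeff_groupSum_pow, ← hy]
        gcongr
        calc ∑ s ∈ y.coeff.support, ‖y.coeff s‖ * ‖π.matrixCoeff ξ ξ s‖ ^ q
            ≤ ∑ s ∈ y.coeff.support, ρ ^ m * ‖π.matrixCoeff ξ ξ s‖ ^ q := by
              gcongr with s
              exact hcoeff s
          _ ≤ ρ ^ m * ∑' s, ‖π.matrixCoeff ξ ξ s‖ ^ q := by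
              rw [← Finset.mul_sum]
              gcongr
              exact hf.sum_le_tsum _ fun s _ => by positivity
    _ = (∑' s, ‖π.matrixCoeff ξ ξ s‖ ^ q) ^ q⁻¹ * (N ^ (1 - q⁻¹) * ρ ^ q⁻¹) ^ m := by
        rw [Real.mul_rpow (by positivity) hA, mul_pow, ← Real.rpow_natCast,
          ← Real.rpow_natCast ρ, ← Real.rpow_natCast (N ^ _), ← Real.rpow_natCast (ρ ^ _),
          ← Real.rpow_mul hN.le, ← Real.rpow_mul hρ.le, ← Real.rpow_mul hN.le,
          ← Real.rpow_mul hρ.le, mul_comm (m : ℝ), mul_comm (m : ℝ)]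
        ring

end groupSum

theorem norm_leftRegularRep_ext_groupSum_letters_le {α : Type u} (c : Bool → α)
    (hc : Function.Injective c) :
    ‖(leftRegularRep (FreeGroup α)).ext
      (groupSum fun g : Bool × Bool => FreeGroup.mk [(c g.1, g.2)])‖ ≤ 7 / 2 := by
  classical
  have hite : ∀ P : Bool × Bool → Prop, (∀ g h, P g → P h → g = h) →
      ∑ g, (if P g then (2 : ℝ) else 1 / 2) ≤ 7 / 2 := by
    intro P hP
    by_cases h : ∃ g, P g
    · obtain ⟨g, hg⟩ := h
      have : ∀ h, P h ↔ h = g := fun h => ⟨fun hh => hP _ _ hh hg, fun hh => hh ▸ hg⟩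
      simp only [this]
      rw [← Finset.add_sum_erase _ _ (Finset.mem_univ g), Finset.sum_congr rfl
        fun h hh => if_neg (Finset.ne_of_mem_erase hh)]
      norm_num
    · push Not at h
      simp only [h, if_false]
      norm_num
  have hsw : ∀ (s : FreeGroup α) (x y : α × Bool), s ∈ FreeGroup.startsWith x →
      s ∈ FreeGroup.startsWith y → x = y := fun s x y hx hy =>
    Option.some_injective _ (hx.symm.trans hy)
  rw [UnitaryRep.ext_groupSum]
  refine norm_sum_leftRegularRep_op_le _
    (fun g s => if s ∈ FreeGroup.startsWith (c g.1, g.2) then 2 else 1 / 2)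
    (fun g s => by split_ifs <;> norm_num) (by norm_num) (fun s => ?_) fun s => ?_
  · refine hite _ fun g h hg hh => ?_
    have := Prod.mk.inj (hsw s _ _ hg hh)
    exact Prod.ext (hc this.1) this.2
  · refine le_trans (Finset.sum_le_sum fun g _ => ?_)
      (hite (fun g => s ∈ FreeGroup.startsWith (c g.1, !g.2)) fun g h hg hh => ?_)
    · by_cases h : s ∈ FreeGroup.startsWith (c g.1, !g.2)
      · rw [if_pos h]
        split_ifs <;> norm_num
      · rw [if_neg h, if_pos (FreeGroup.startsWith_mk_mul s h)]
        norm_num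
    · have := Prod.mk.inj (hsw s _ _ hg hh)
      exact Prod.ext (hc this.1) (Bool.not_inj this.2)

section Tilt

variable {E : Type*} [NormedAddCommGroup E] [InnerProductSpace ℂ E]

/-- The reflection which, for orthonormal `e`, `f` and `t ^ 2 + s ^ 2 = 1`, maps `f` to
`t • e + s • f` and fixes the orthogonal complement of `e` and `f`. -/
noncomputable def tilt (e f : E) (t s : ℝ) : E ≃ₗᵢ[ℂ] E :=
  (ℂ ∙ (((1 + s : ℝ) : ℂ) • e - (t : ℂ) • f))ᗮ.reflection

variable {e f : E} {t s : ℝ}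

theorem tilt_of_inner_eq_zero {z : E} (he : inner ℂ e z = 0) (hf : inner ℂ f z = 0) :
    tilt e f t s z = z := by
  refine Submodule.reflection_mem_subspace_eq_self ?_
  rw [Submodule.mem_orthogonal_singleton_iff_inner_right]
  simp [-Complex.coe_smul, inner_sub_left, inner_smul_left, he, hf]

theorem tilt_apply_orthonormal (he : ‖e‖ = 1) (hf : ‖f‖ = 1) (hef : inner ℂ e f = 0)
    (hts : t ^ 2 + s ^ 2 = 1) (hs : 0 < 1 + s) :
    tilt e f t s f = (t : ℂ) • e + (s : ℂ) • f ∧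
      tilt e f t s e = (t : ℂ) • f - (s : ℂ) • e := by
  set u : E := ((1 + s : ℝ) : ℂ) • e - (t : ℂ) • f with hu
  set v : E := (t : ℂ) • e + ((1 + s : ℝ) : ℂ) • f with hv
  have hfe : inner ℂ f e = 0 := by rw [← inner_conj_symm, hef, map_zero]
  have h1 : tilt e f t s u = -u := Submodule.reflection_orthogonalComplement_singleton_eq_neg u
  have h2 : tilt e f t s v = v := by
    refine Submodule.reflection_mem_subspace_eq_self ?_
    rw [Submodule.mem_orthogonal_singleton_iff_inner_right, hv]
    simp [-Complex.coe_smul, inner_sub_left, inner_smul_left, inner_add_right, inner_smul_right, hef, hfe,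
      inner_self_eq_norm_sq_to_K, he, hf]
    ring
  have hts' : (t : ℂ) ^ 2 + (s : ℂ) ^ 2 = 1 := by exact_mod_cast hts
  have hs' : (1 + s : ℂ) ≠ 0 := by exact_mod_cast hs.ne'
  have hs2 : (2 * (1 + s) : ℂ) ≠ 0 := mul_ne_zero two_ne_zero hs'
  have hfuv : (2 * (1 + s) : ℂ) • f = (1 + s : ℂ) • v - (t : ℂ) • u := by
    rw [hu, hv]
    push_cast
    match_scalars <;> first | ring1 | linear_combination hts' | linear_combination -hts'
  have heuv : (2 * (1 + s) : ℂ) • e = (t : ℂ) • v + (1 + s : ℂ) • u := by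
    rw [hu, hv]
    push_cast
    match_scalars <;> first | ring1 | linear_combination hts' | linear_combination -hts'
  constructor
  · refine smul_right_injective E hs2 ?_
    change (2 * (1 + s) : ℂ) • _ = (2 * (1 + s) : ℂ) • _
    rw [← map_smul, hfuv, map_sub, map_smul, map_smul, h1, h2, hu, hv]
    push_cast
    match_scalars <;> first | ring1 | linear_combination hts' | linear_combination -hts'
  · refine smul_right_injective E hs2 ?_
    change (2 * (1 + s) : ℂ) • _ = (2 * (1 + s) : ℂ) • _
    rw [← map_smul, heuv, map_add, map_smul, map_smul, h1, h2, hu, hv]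
    push_cast
    match_scalars <;> first | ring1 | linear_combination hts'

end Tilt

section Delta

variable {Γ : Type u}

section Basis

variable [DecidableEq Γ]

/-- The canonical orthonormal basis of `ℓ²(Γ)`. -/
noncomputable def delta (x : Γ) : lp (fun _ : Γ => ℂ) 2 := lp.single 2 x 1

theorem delta_apply (x y : Γ) : delta x y = if y = x then 1 else 0 := by
  rw [delta, lp.single_apply, Pi.single_apply]

theorem norm_delta (x : Γ) : ‖delta x‖ = 1 := by
  rw [delta, lp.norm_single (by norm_num), norm_one]

theorem inner_delta (x : Γ) (f : lp (fun _ : Γ => ℂ) 2) : inner ℂ (delta x) f = f x := by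
  rw [delta, lp.inner_single_left]
  simp

theorem dense_span_delta :
    Dense (Submodule.span ℂ (Set.range (delta : Γ → lp (fun _ : Γ => ℂ) 2)) :
      Set (lp (fun _ : Γ => ℂ) 2)) := by
  set b := HilbertBasis.ofRepr (LinearIsometryEquiv.refl ℂ (lp (fun _ : Γ => ℂ) 2))
  have hb : ⇑b = delta := funext fun x => b.repr_self x
  rw [Submodule.dense_iff_topologicalClosure_eq_top, ← hb]
  exact b.dense_span

end Basis

variable [Group Γ]

theorem leftTranslate_apply (s t : Γ) (f : lp (fun _ : Γ => ℂ) 2) :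
    leftTranslate s f t = f (s⁻¹ * t) := rfl

theorem leftTranslate_delta [DecidableEq Γ] (s x : Γ) : leftTranslate s (delta x) = delta (s * x) := by
  apply lp.ext
  funext y
  rw [leftTranslate_apply, delta_apply, delta_apply]
  simp only [inv_mul_eq_iff_eq_mul]

end Delta

theorem UnitaryRep.isIdealRep_of_cyclic {Γ : Type u} [Group Γ] (π : UnitaryRep Γ) (ξ : π.H)
    (hξ : Dense (Submodule.span ℂ (Set.range fun x => π.op x ξ) : Set π.H)) {p : ℝ≥0∞}
    (hp : 0 < p.toReal) (hf : Memℓp (fun s => inner ℂ ξ (π.op s ξ) : Γ → ℂ) p) :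
    π.IsIdealRep (lpIdeal Γ p) := by
  refine ⟨_, hξ, fun η hη ζ hζ => ?_⟩
  change Memℓp (fun s => inner ℂ ζ (π.op s η) : Γ → ℂ) p
  have hmul : ∀ (x y : Γ) (η : π.H), π.op (x * y) η = π.op x (π.op y η) := fun x y η => by
    simp [UnitaryRep.op]
  induction hη using Submodule.span_induction with
  | zero =>
    simp only [map_zero, inner_zero_right]
    exact zero_memℓp
  | add η η' _ _ h h' =>
    simp only [map_add, inner_add_right]
    exact h.add h'
  | smul a η _ h =>
    simp only [map_smul, inner_smul_right]
    exact h.const_smul a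
  | mem η hη =>
    obtain ⟨x, rfl⟩ := hη
    induction hζ using Submodule.span_induction with
    | zero =>
      simp only [inner_zero_left]
      exact zero_memℓp
    | add ζ ζ' _ _ h h' =>
      simp only [inner_add_left]
      exact h.add h'
    | smul a ζ _ h =>
      simp only [inner_smul_left]
      exact h.const_smul (conj a)
    | mem ζ hζ =>
      obtain ⟨y, rfl⟩ := hζ
      have h : ∀ s, inner ℂ (π.op y ξ) (π.op s (π.op x ξ)) =
          inner ℂ ξ (π.op (y⁻¹ * (s * x)) ξ) := fun s => by
        rw [hmul, ← hmul s, ← π.adjoint_op, ContinuousLinearMap.star_eq_adjoint,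
          ContinuousLinearMap.adjoint_inner_right]
      simp only [h]
      exact memℓp_gen (Equiv.summable_iff ((Equiv.mulRight x).trans (Equiv.mulLeft y⁻¹))
        (f := fun s => ‖(inner ℂ ξ (π.op s ξ) : ℂ)‖ ^ p.toReal) |>.2 (hf.summable hp))

section FreeGroup

variable {α : Type u}

theorem FreeGroup.mk_singleton_false (a : α) :
    FreeGroup.mk [(a, false)] = (FreeGroup.of a)⁻¹ := rfl

theorem FreeGroup.IsReduced.head?_ne {g : α × Bool} {l : List (α × Bool)}
    (h : FreeGroup.IsReduced (g :: l)) : l[0]? ≠ some (g.1, !g.2) := by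
  cases l with
  | nil => simp
  | cons b l =>
    have := (FreeGroup.isReduced_cons_cons.1 h).1
    rintro hb
    simp only [List.getElem?_cons_zero, Option.some.injEq] at hb
    subst hb
    simp at this

theorem FreeGroup.IsReduced.tail {g : α × Bool} {l : List (α × Bool)}
    (h : FreeGroup.IsReduced (g :: l)) : FreeGroup.IsReduced l :=
  h.infix (List.suffix_cons g l).isInfix

theorem FreeGroup.inv_mk_singleton (g : α × Bool) :
    (FreeGroup.mk [g])⁻¹ = FreeGroup.mk [(g.1, !g.2)] := rfl

theorem FreeGroup.mk_cons (g : α × Bool) (l : List (α × Bool)) :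
    FreeGroup.mk (g :: l) = FreeGroup.mk [g] * FreeGroup.mk l := rfl

end FreeGroup

section Haagerup

variable {α : Type u} [DecidableEq α] (t : α → ℝ)

/-- A unitary representation of the free group on `ℓ²`, a perturbation of the left regular
representation, in which `δ_1` has matrix coefficient the product of the weights `t` of the letters
of the reduced word. -/
noncomputable def haagerupRep : UnitaryRep (FreeGroup α) where
  H := lp (fun _ : FreeGroup α => ℂ) 2
  hom := FreeGroup.lift fun a => Unitary.linearIsometryEquiv.symm
    ((leftTranslate (FreeGroup.of a)).trans
      (tilt (delta 1) (delta (FreeGroup.of a)) (t a) √(1 - t a ^ 2)))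

/-- The operators of `haagerupRep` on `ℓ²`. -/
noncomputable def haagerupOp (x : FreeGroup α) :
    lp (fun _ : FreeGroup α => ℂ) 2 →L[ℂ] lp (fun _ : FreeGroup α => ℂ) 2 :=
  (haagerupRep t).op x

theorem haagerupOp_mul (x y : FreeGroup α) (f : lp (fun _ : FreeGroup α => ℂ) 2) :
    haagerupOp t (x * y) f = haagerupOp t x (haagerupOp t y f) := by
  simp only [haagerupOp, UnitaryRep.op, map_mul]
  rfl

theorem haagerupOp_one (f : lp (fun _ : FreeGroup α => ℂ) 2) : haagerupOp t 1 f = f := by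
  simp only [haagerupOp, UnitaryRep.op, map_one]
  rfl

theorem haagerupOp_of (a : α) (f : lp (fun _ : FreeGroup α => ℂ) 2) :
    haagerupOp t (FreeGroup.of a) f = tilt (delta 1) (delta (FreeGroup.of a)) (t a) √(1 - t a ^ 2)
      (leftTranslate (FreeGroup.of a) f) := by
  simp only [haagerupOp, UnitaryRep.op, haagerupRep]
  rfl

theorem haagerupOp_inv_eq {x : FreeGroup α} {f g : lp (fun _ : FreeGroup α => ℂ) 2}
    (h : haagerupOp t x f = g) : haagerupOp t x⁻¹ g = f := by
  rw [← h, ← haagerupOp_mul, inv_mul_cancel, haagerupOp_one]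

theorem haagerupOp_letter_of_apply_eq_zero (g : α × Bool) (f : lp (fun _ : FreeGroup α => ℂ) 2)
    (h1 : f 1 = 0) (hg : f (FreeGroup.mk [g])⁻¹ = 0) :
    haagerupOp t (FreeGroup.mk [g]) f = leftTranslate (FreeGroup.mk [g]) f := by
  obtain ⟨a, ε⟩ := g
  cases ε with
  | true =>
    change f (FreeGroup.of a)⁻¹ = 0 at hg
    change haagerupOp t (FreeGroup.of a) f = leftTranslate (FreeGroup.of a) f
    rw [haagerupOp_of, tilt_of_inner_eq_zero]
    · rw [inner_delta, leftTranslate_apply, mul_one, hg]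
    · rw [inner_delta, leftTranslate_apply, inv_mul_cancel, h1]
  | false =>
    rw [FreeGroup.mk_singleton_false, inv_inv] at hg
    rw [FreeGroup.mk_singleton_false]
    apply haagerupOp_inv_eq
    have h : leftTranslate (FreeGroup.of a) (leftTranslate (FreeGroup.of a)⁻¹ f) = f :=
      (leftTranslate (FreeGroup.of a)).apply_symm_apply f
    rw [haagerupOp_of, h, tilt_of_inner_eq_zero]
    · rw [inner_delta, h1]
    · rw [inner_delta, hg]

variable {t}

theorem haagerupOp_letter_delta_one (ht₀ : ∀ a, 0 ≤ t a) (ht₁ : ∀ a, t a < 1) (g : α × Bool) :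
    ∃ c : ℂ, c ≠ 0 ∧ haagerupOp t (FreeGroup.mk [g]) (delta 1) =
      (t g.1 : ℂ) • delta 1 + c • delta (FreeGroup.mk [g]) := by
  obtain ⟨a, ε⟩ := g
  have hpos : 0 < 1 - t a ^ 2 := by nlinarith [ht₀ a, ht₁ a]
  have hs := Real.sqrt_pos.2 hpos
  have hts : t a ^ 2 + √(1 - t a ^ 2) ^ 2 = 1 := by rw [Real.sq_sqrt hpos.le]; ring
  have hne : FreeGroup.of a ≠ 1 := FreeGroup.of_ne_one a
  have hT := tilt_apply_orthonormal (norm_delta (1 : FreeGroup α)) (norm_delta (FreeGroup.of a))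
    (by rw [inner_delta, delta_apply, if_neg hne.symm]) hts (by linarith)
  cases ε with
  | true =>
    refine ⟨(√(1 - t a ^ 2) : ℝ), by exact_mod_cast hs.ne', ?_⟩
    change haagerupOp t (FreeGroup.of a) (delta 1) = _
    rw [haagerupOp_of, leftTranslate_delta, mul_one, hT.1]
    rfl
  | false =>
    refine ⟨-(√(1 - t a ^ 2) : ℝ), by simpa using hs.ne', ?_⟩
    rw [FreeGroup.mk_singleton_false]
    apply haagerupOp_inv_eq
    have hts' : (t a : ℂ) ^ 2 + (√(1 - t a ^ 2) : ℂ) ^ 2 = 1 := by exact_mod_cast hts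
    rw [haagerupOp_of]
    simp only [map_add, map_smul, leftTranslate_delta, mul_one, mul_inv_cancel, hT.1, hT.2]
    match_scalars <;> first | ring1 | linear_combination hts'

theorem haagerupOp_delta_one (ht₀ : ∀ a, 0 ≤ t a) (ht₁ : ∀ a, t a < 1) :
    ∀ l : List (α × Bool), FreeGroup.IsReduced l →
      haagerupOp t (FreeGroup.mk l) (delta 1) 1 = ((l.map fun g => t g.1).prod : ℝ) ∧
      ∀ y : FreeGroup α, y ≠ 1 → haagerupOp t (FreeGroup.mk l) (delta 1) y ≠ 0 →
        y.toWord[0]? = l[0]? := by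
  intro l
  induction l with
  | nil =>
    intro _
    change haagerupOp t 1 (delta 1) 1 = _ ∧ ∀ y : FreeGroup α, y ≠ 1 →
      haagerupOp t 1 (delta 1) y ≠ 0 → _
    simp only [haagerupOp_one, delta_apply]
    simp
  | cons g l ih =>
    intro hl
    obtain ⟨ih1, ih2⟩ := ih hl.tail
    obtain ⟨c, -, hc⟩ := haagerupOp_letter_delta_one ht₀ ht₁ g
    set v := haagerupOp t (FreeGroup.mk l) (delta 1) with hv
    set r := v - v 1 • delta 1 with hr
    have hr_eq : ∀ y, r y = v y - v 1 * delta 1 y := fun y => rfl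
    have hr_apply : ∀ y, y ≠ 1 → r y = v y := fun y hy => by
      rw [hr_eq, delta_apply, if_neg hy, mul_zero, sub_zero]
    have hr1 : r 1 = 0 := by rw [hr_eq, delta_apply, if_pos rfl, mul_one, sub_self]
    have hg1 : FreeGroup.mk [g] ≠ 1 := fun h => by
      simpa using congrArg FreeGroup.toWord h
    have hrg : r (FreeGroup.mk [g])⁻¹ = 0 := by
      rw [hr_apply _ (inv_ne_one.2 hg1)]
      by_contra h
      refine hl.head?_ne ?_
      rw [← ih2 _ (inv_ne_one.2 hg1) h, FreeGroup.inv_mk_singleton]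
      simp
    have hgl : haagerupOp t (FreeGroup.mk (g :: l)) (delta 1) =
        v 1 • ((t g.1 : ℂ) • delta 1 + c • delta (FreeGroup.mk [g])) +
          leftTranslate (FreeGroup.mk [g]) r := by
      rw [FreeGroup.mk_cons, haagerupOp_mul, ← hv,
        ← haagerupOp_letter_of_apply_eq_zero t g r hr1 hrg, ← hc, ← map_smul, ← map_add, hr,
        add_sub_cancel]
    have happ : ∀ y, haagerupOp t (FreeGroup.mk (g :: l)) (delta 1) y =
        v 1 * (t g.1 * delta 1 y + c * delta (FreeGroup.mk [g]) y) +
          r ((FreeGroup.mk [g])⁻¹ * y) := fun y => by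
      rw [hgl]
      rfl
    refine ⟨?_, fun y hy hne => ?_⟩
    · rw [happ, mul_one, hrg, delta_apply, delta_apply, if_pos rfl, if_neg hg1.symm, ih1]
      simp [mul_comm]
    · rw [happ, delta_apply, delta_apply, if_neg hy] at hne
      by_cases hyg : y = FreeGroup.mk [g]
      · rw [hyg]
        simp
      · rw [if_neg hyg] at hne
        have hne' : (FreeGroup.mk [g])⁻¹ * y ≠ 1 := fun h => hyg (inv_mul_eq_one.1 h).symm
        rw [mul_zero, mul_zero, add_zero, mul_zero, zero_add, hr_apply _ hne'] at hne
        have h0 := ih2 _ hne' hne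
        have hmem : (FreeGroup.mk [g])⁻¹ * y ∉ FreeGroup.startsWith (g.1, !g.2) := fun h =>
          hl.head?_ne (h0.symm.trans h)
        have := FreeGroup.startsWith_mk_mul _ hmem
        rw [mul_inv_cancel_left] at this
        exact this

theorem delta_mem_span_haagerupOp (ht₀ : ∀ a, 0 ≤ t a) (ht₁ : ∀ a, t a < 1) :
    ∀ l : List (α × Bool), FreeGroup.IsReduced l → delta (FreeGroup.mk l) ∈
      Submodule.span ℂ (Set.range fun x => haagerupOp t x (delta 1)) := by
  set W := Submodule.span ℂ (Set.range fun x => haagerupOp t x (delta 1)) with hW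
  have hinv : ∀ x, ∀ f ∈ W, haagerupOp t x f ∈ W := by
    intro x f hf
    induction hf using Submodule.span_induction with
    | zero => simp
    | add f f' _ _ h h' =>
      rw [map_add]
      exact W.add_mem h h'
    | smul a f _ h =>
      rw [map_smul]
      exact W.smul_mem a h
    | mem f hf =>
      obtain ⟨y, rfl⟩ := hf
      exact Submodule.subset_span ⟨x * y, haagerupOp_mul t x y _⟩
  have h1 : delta 1 ∈ W := Submodule.subset_span ⟨1, haagerupOp_one t _⟩
  intro l
  induction l with
  | nil => exact fun _ => h1
  | cons g l ih =>
    intro hl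
    rcases eq_or_ne l [] with rfl | hne
    · obtain ⟨c, hc0, hc⟩ := haagerupOp_letter_delta_one ht₀ ht₁ g
      have : c • delta (FreeGroup.mk [g]) ∈ W := by
        rw [← add_sub_cancel_left ((t g.1 : ℂ) • delta 1) (c • delta (FreeGroup.mk [g])), ← hc]
        exact W.sub_mem (hinv _ _ h1) (W.smul_mem _ h1)
      exact (W.smul_mem_iff hc0).1 this
    · have hw : (FreeGroup.mk l).toWord = l := by
        rw [FreeGroup.toWord_mk, hl.tail.reduce_eq]
      have hl1 : FreeGroup.mk l ≠ 1 := fun h => hne (by rw [← hw, h, FreeGroup.toWord_one])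
      have hlg : FreeGroup.mk l ≠ (FreeGroup.mk [g])⁻¹ := fun h => hl.head?_ne (by
        rw [← hw, h, FreeGroup.inv_mk_singleton]
        simp)
      have := hinv (FreeGroup.mk [g]) _ (ih hl.tail)
      rwa [haagerupOp_letter_of_apply_eq_zero, leftTranslate_delta] at this
      · rw [delta_apply, if_neg hl1.symm]
      · rw [delta_apply, if_neg hlg.symm]

theorem dense_span_haagerupOp (ht₀ : ∀ a, 0 ≤ t a) (ht₁ : ∀ a, t a < 1) :
    Dense (Submodule.span ℂ (Set.range fun x => haagerupOp t x (delta 1)) :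
      Set (lp (fun _ : FreeGroup α => ℂ) 2)) := by
  refine dense_span_delta.mono (Submodule.span_le.2 ?_)
  rintro _ ⟨x, rfl⟩
  rw [← FreeGroup.mk_toWord (x := x)]
  exact delta_mem_span_haagerupOp ht₀ ht₁ _ FreeGroup.isReduced_toWord

theorem inner_haagerupOp (ht₀ : ∀ a, 0 ≤ t a) (ht₁ : ∀ a, t a < 1) (x : FreeGroup α) :
    inner ℂ (delta 1) (haagerupOp t x (delta 1)) =
      ((x.toWord.map fun g => t g.1).prod : ℝ) := by
  rw [inner_delta, ← (haagerupOp_delta_one ht₀ ht₁ _ FreeGroup.isReduced_toWord).1,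
    FreeGroup.mk_toWord]

theorem haagerupRep_isIdealRep (ht₀ : ∀ a, 0 ≤ t a) (ht₁ : ∀ a, t a < 1) {p : ℝ≥0∞}
    (hp : 0 < p.toReal)
    (hs : Summable fun l : List (α × Bool) => (l.map fun g => t g.1).prod ^ p.toReal) :
    (haagerupRep t).IsIdealRep (lpIdeal (FreeGroup α) p) := by
  refine UnitaryRep.isIdealRep_of_cyclic _ (delta 1 : lp (fun _ : FreeGroup α => ℂ) 2)
    (dense_span_haagerupOp ht₀ ht₁) hp (memℓp_gen ?_)
  refine (hs.comp_injective FreeGroup.toWord_injective).congr fun x => ?_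
  refine Eq.trans ?_ (congrArg (‖·‖ ^ p.toReal) (inner_haagerupOp ht₀ ht₁ x)).symm
  rw [Complex.norm_real, Real.norm_of_nonneg]
  · rfl
  · refine List.prod_nonneg fun r hr => ?_
    obtain ⟨g, -, rfl⟩ := List.mem_map.1 hr
    exact ht₀ _

theorem le_norm_haagerupRep_ext_groupSum (ht₀ : ∀ a, 0 ≤ t a) (ht₁ : ∀ a, t a < 1)
    {L : Type*} [Fintype L] (ψ : L → α × Bool) :
    ∑ g, t (ψ g).1 ≤ ‖(haagerupRep t).ext (groupSum fun g => FreeGroup.mk [ψ g])‖ := by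
  rw [UnitaryRep.ext_groupSum]
  change _ ≤ ‖∑ g, haagerupOp t (FreeGroup.mk [ψ g])‖
  have h : inner ℂ (delta 1) ((∑ g, haagerupOp t (FreeGroup.mk [ψ g])) (delta 1)) =
      ((∑ g, t (ψ g).1 : ℝ) : ℂ) := by
    rw [sum_apply, inner_sum, Complex.ofReal_sum]
    refine Finset.sum_congr rfl fun g _ => ?_
    rw [inner_haagerupOp ht₀ ht₁]
    simp
  have h' := norm_inner_le_norm (𝕜 := ℂ) (delta 1 : lp (fun _ : FreeGroup α => ℂ) 2)
    ((∑ g, haagerupOp t (FreeGroup.mk [ψ g])) (delta 1))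
  rw [h, Complex.norm_real, norm_delta, one_mul] at h'
  refine (Real.le_norm_self _).trans (h'.trans ((ContinuousLinearMap.le_opNorm _ _).trans ?_))
  rw [norm_delta, mul_one]

end Haagerup

theorem summable_pow_length {L : Type*} [Fintype L] {r : ℝ} (hr : 0 ≤ r)
    (hr' : Fintype.card L * r < 1) : Summable fun l : List L => r ^ l.length := by
  rw [← List.equivSigmaTuple.symm.summable_iff, summable_sigma_of_nonneg]
  · refine ⟨fun n => (hasSum_fintype _).summable, ?_⟩
    refine (summable_geometric_of_lt_one (by positivity) hr').congr fun n => ?_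
    rw [tsum_fintype]
    simp [List.equivSigmaTuple, mul_pow]
  · exact fun x => pow_nonneg hr _

theorem summable_prod_letter_weights {α : Type u} (c : Bool → α) (hc : Function.Injective c)
    [DecidablePred (· ∈ Set.range c)] {τ q : ℝ} (hτ : 0 ≤ τ) (hq : 0 < q) (h : 4 * τ ^ q < 1) :
    Summable fun l : List (α × Bool) =>
      (l.map fun g => if g.1 ∈ Set.range c then τ else 0).prod ^ q := by
  have hinj : Function.Injective (List.map fun g : Bool × Bool => (c g.1, g.2)) :=
    List.map_injective_iff.2 fun g h hgh =>
      Prod.ext (hc (Prod.mk.inj hgh).1) (Prod.mk.inj hgh).2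
  refine (hinj.summable_iff fun l hl => ?_).1 ?_
  · rw [List.prod_eq_zero, Real.zero_rpow hq.ne']
    simp only [Set.range_list_map, Set.mem_ofPred_eq, not_forall] at hl
    obtain ⟨g, hg, hgc⟩ := hl
    refine List.mem_map.2 ⟨g, hg, if_neg ?_⟩
    rintro ⟨i, hi⟩
    exact hgc ⟨(i, g.2), Prod.ext hi rfl⟩
  · refine (summable_pow_length (L := Bool × Bool) (r := τ ^ q) (by positivity)
      (by simpa using h)).congr fun l => ?_
    simp only [Function.comp_def, List.map_map, Set.mem_range_self, if_true, List.map_const',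
      List.prod_replicate]
    rw [← Real.rpow_natCast, ← Real.rpow_natCast, ← Real.rpow_mul hτ, ← Real.rpow_mul hτ, mul_comm]

/-- The trivial representation. -/
noncomputable def trivialRep (Γ : Type u) [Group Γ] : UnitaryRep Γ where
  H := EuclideanSpace ℂ PUnit.{u + 1}
  hom := 1

theorem norm_trivialRep_ext_groupSum {Γ : Type u} [Group Γ] {L : Type*} [Fintype L] (ψ : L → Γ) :
    ‖(trivialRep Γ).ext (groupSum ψ)‖ = Fintype.card L := by
  have : Nontrivial (trivialRep Γ).H :=
    inferInstanceAs (Nontrivial (EuclideanSpace ℂ PUnit.{u + 1}))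
  have h : ∀ s, (trivialRep Γ).op s = 1 := fun _ => rfl
  rw [UnitaryRep.ext_groupSum]
  simp only [h, Finset.sum_const, Finset.card_univ, nsmul_eq_mul, mul_one]
  rw [← map_natCast (algebraMap ℂ _), norm_algebraMap']
  simp

theorem mainTheorem10 (α : Type u) [Nontrivial α] :
    ∃ p : ℝ≥0∞, 2 < p ∧ p < ∞ ∧
      (¬ ∃ φ : FullGroupCStar (FreeGroup α) ≃⋆ₐ[ℂ]
            IdealGroupCStar (lpIdeal (FreeGroup α) p),
          ∀ x : MonoidAlgebra ℂ (FreeGroup α),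
            φ (GroupCStar.ofGroupRing _ x) = GroupCStar.ofGroupRing _ x) ∧
      (¬ ∃ φ : IdealGroupCStar (lpIdeal (FreeGroup α) p) ≃⋆ₐ[ℂ]
            ReducedGroupCStar (FreeGroup α),
          ∀ x : MonoidAlgebra ℂ (FreeGroup α),
            φ (GroupCStar.ofGroupRing _ x) = GroupCStar.ofGroupRing _ x) := by
  classical
  obtain ⟨a, b, hab⟩ := exists_pair_ne α
  set c : Bool → α := fun i => if i then a else b with hc_def
  have hc : Function.Injective c := by
    intro i j hij
    cases i <;> cases j <;> simp_all [eq_comm]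
  set x := groupSum fun g : Bool × Bool => FreeGroup.mk [(c g.1, g.2)]
  have hred := norm_leftRegularRep_ext_groupSum_letters_le c hc
  have hp : (14 : ℝ≥0∞).toReal = 14 := by simp
  refine ⟨14, by norm_num, by simp, ?_, ?_⟩
  · rintro ⟨φ, hφ⟩
    have heq := repNorm_eq_of_starAlgEquiv φ hφ x
    have h4 : 4 ≤ repNorm Set.univ x := by
      refine le_trans (le_of_eq ?_)
        (norm_ext_le_repNorm (Set.mem_univ (trivialRep (FreeGroup α))) x)
      rw [norm_trivialRep_ext_groupSum]
      simp
    have hlt : (4 : ℝ) ^ (1 - (14 : ℝ)⁻¹) * (7 / 2) ^ (14 : ℝ)⁻¹ < 4 := by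
      calc (4 : ℝ) ^ (1 - (14 : ℝ)⁻¹) * (7 / 2) ^ (14 : ℝ)⁻¹
          < (4 : ℝ) ^ (1 - (14 : ℝ)⁻¹) * 4 ^ (14 : ℝ)⁻¹ := by
            gcongr
            norm_num
        _ = 4 := by
            rw [← Real.rpow_add (by norm_num), sub_add_cancel, Real.rpow_one]
    refine (h4.trans_eq heq).not_gt (lt_of_le_of_lt (repNorm_le (by positivity) ?_) hlt)
    intro π hπ
    have := UnitaryRep.IsIdealRep.norm_ext_groupSum_le
      (fun g : Bool × Bool => FreeGroup.mk [(c g.1, g.2)])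
      ((Equiv.refl Bool).prodCongr Equiv.boolNot) (fun g => rfl) (by norm_num) hred
      (by norm_num) (by simp) hπ
    simpa [hp] using this
  · rintro ⟨φ, hφ⟩
    have heq := repNorm_eq_of_starAlgEquiv φ hφ x
    set t : α → ℝ := fun i => if i ∈ Set.range c then 9 / 10 else 0 with ht
    have ht₀ : ∀ i, 0 ≤ t i := fun i => by simp only [ht]; split_ifs <;> norm_num
    have ht₁ : ∀ i, t i < 1 := fun i => by simp only [ht]; split_ifs <;> norm_num
    have hideal : (haagerupRep t).IsIdealRep (lpIdeal (FreeGroup α) 14) := by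
      refine haagerupRep_isIdealRep ht₀ ht₁ (by simp) ?_
      rw [hp]
      refine summable_prod_letter_weights c hc (by norm_num) (by norm_num) ?_
      norm_num
    have hlow := (le_norm_haagerupRep_ext_groupSum ht₀ ht₁
      fun g : Bool × Bool => (c g.1, g.2)).trans (norm_ext_le_repNorm
      (R := {π | π.IsIdealRep (lpIdeal (FreeGroup α) 14)}) hideal x)
    have hsum : ∑ g : Bool × Bool, t (c g.1) = 18 / 5 := by
      simp only [ht, Set.mem_range_self, if_true]
      norm_num
    have hup : repNorm {leftRegularRep (FreeGroup α)} x ≤ 7 / 2 :=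
      repNorm_le (by norm_num) fun π hπ => by
        rw [Set.mem_singleton_iff.1 hπ]
        exact hred
    have := (hsum.symm.trans_le hlow).trans (heq.trans_le hup)
    norm_num at this
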